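/- Model. There are $N\ge 1$ humans and $M\ge 2$ actions. Human $h$ has a private reward function $R_h:\{1,\dots,M\}\to[0,\infty)$, normalized by $\sum_a R_h(a)=1$. The mechanism $\mathcal M$ starts with $\mathrm{Actions}[h]=\{1,\dots,M\}$ for every $h$ and $\mathrm{Score}[a]=0$ for every $a$, and plays rounds $t=1,\dots,M$. In round $t$ the humans $h=1,\dots,N$ choose, one after the other (one time step each), an action $a$, which may depend on all choices made so far. If $a\in\mathrm{Actions}[h]$, then $a$ is executed (human $h$ receives the reward $R_h(a)$), $\mathrm{Score}[a]$ is increased by $1/t$, and $a$ is removed from $\mathrm{Actions}[h]$; otherwise nothing happens and $h$ receives nothing. At the end of each round, with probability $1-2^{-1/M}$ the mechanism stops and returns an action drawn uniformly from $\{1,\dots,M\}$. If it has not stopped by the end of round $M$, it returns action $a$ with probability $\mathrm{Score}[a]/\sum_{a'}\mathrm{Score}[a']$. Human $h$ has a discount factor $\gamma_h\in(0,1)$ per time step, and plans optimally: given the strategies of the others, no strategy gives $h$ a larger expected total discounted reward from the executed actions. Let $a_{\mathcal M}(R)$ be the action that the mechanism returns when all humans plan optimally. The distortion of $\mathcal M$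 with respect to utilitarian welfare is $$\triangle(\mathcal M)=\sup_R\ \frac{\max_a\sum_h R_h(a)}{\mathbb E\big[\sum_h R_h(a_{\mathcal M}(R))\big]},$$ where the supremum is over all normalized reward profiles $R$ and, if several optimal behaviours of the humans exist for $R$, over all of them. Proposition. For every normalized reward profile an optimal behaviour of the humans exists, and $$\triangle(\mathcal M)=O\big(\sqrt{M\log M}\big),$$ that is, there is an absolute constant $C>0$ such that $\triangle(\mathcal M)\le C\sqrt{M\log M}$ for all $M\ge 2$, all $N\ge 1$ and all discount factors $\gamma_1,\dots,\gamma_N\in(0,1)$. -/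

import Mathlib

open scoped ENNReal

namespace Collab

/-- A strategy of a human: given the public history (the list of all actions chosen so far by all
humans, oldest first, executed or not), it prescribes the next choice. The length of the history
tells the human the current time step. -/
abbrev Strategy (M : ℕ) : Type := List (Fin M) → Fin M

/-- The state of an interaction of `N` humans (each with `M` possible actions) with the robot. -/
structure State (N M : ℕ) where
  /-- all actions chosen so far, oldest first; its length is the number of elapsed time steps -/
  history : List (Fin M)
  /-- `Actions[h]`: the actions that human `h` has not chosen yet -/
  actions : Fin N → Finset (Fin M)
  /-- `Score[a]` -/
  score : Fin M → ℝ
  /-- the total discounted reward that human `h` has collected so far -/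
  earned : Fin N → ℝ

/-- The state before the first round. -/
def State.init (N M : ℕ) : State N M where
  history := []
  actions := fun _ => Finset.univ
  score := fun _ => 0
  earned := fun _ => 0

variable {N M : ℕ}

/-- One time step, in round `t` (counted from 1): human `h` chooses an action `a`. If `a` still
belongs to `Actions[h]`, it is executed, that is, `h` receives the reward `R h a` (discounted with
the factor `γ h` per elapsed time step); then `Score[a]` grows by `1 / t` and `a` is removed from
`Actions[h]`. Otherwise nothing happens. -/
noncomputable def step (R : Fin N → Fin M → ℝ) (γ : Fin N → ℝ) (σ : Fin N → Strategy M)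
    (t : ℕ) (s : State N M) (h : Fin N) : State N M :=
  let a := σ h s.history
  if a ∈ s.actions h then
    { history := s.history ++ [a]
      actions := Function.update s.actions h ((s.actions h).erase a)
      score := Function.update s.score a (s.score a + 1 / (t : ℝ))
      earned := Function.update s.earned h
        (s.earned h + γ h ^ s.history.length * R h a) }
  else
    { s with history := s.history ++ [a] }

/-- Round `t`: the humans `0, 1, …, N - 1` choose one after the other. -/
noncomputable def playRound (R : Fin N → Fin M → ℝ) (γ : Fin N → ℝ) (σ : Fin N → Strategy M)
    (t : ℕ) (s : State N M) : State N M :=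
  (List.finRange N).foldl (step R γ σ t) s

/-- The probability `1 - 1 / 2 ^ (1 / M)` with which the robot stops at the end of a round. -/
noncomputable def stopProb (M : ℕ) : ℝ := 1 - 1 / (2 : ℝ) ^ (1 / (M : ℝ))

/-- The remaining part of a run when `k` rounds are left, the next of them is round `t` and the
current state is `s`: the expectation of `f s' a`, where `s'` is the state in which the robot stops
and `a` is the action which it then returns. At the end of each round the robot stops with
probability `stopProb M` and then returns a uniformly distributed action; when no round is left it
returns `a` with probability `Score[a] / ∑ a', Score[a']`. -/
noncomputable def expectFrom (R : Fin N → Fin M → ℝ) (γ : Fin N → ℝ) (σ : Fin N → Strategy M)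
    (f : State N M → Fin M → ℝ) : ℕ → ℕ → State N M → ℝ
  | 0, _, s => ∑ a, s.score a / (∑ a', s.score a') * f s a
  | k + 1, t, s =>
      stopProb M * (∑ a, 1 / (M : ℝ) * f (playRound R γ σ t s) a) +
        (1 - stopProb M) * expectFrom R γ σ f k (t + 1) (playRound R γ σ t s)

/-- Expectation of `f s a` over a whole run of the mechanism, that is, of the rounds `1, …, M`;
`s` is the final state and `a` the action that the robot returns. -/
noncomputable def expect (R : Fin N → Fin M → ℝ) (γ : Fin N → ℝ) (σ : Fin N → Strategy M)
    (f : State N M → Fin M → ℝ) : ℝ :=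
  expectFrom R γ σ f M 1 (State.init N M)

/-- The expected total discounted reward that human `h` collects during the collaboration. -/
noncomputable def payoff (R : Fin N → Fin M → ℝ) (γ : Fin N → ℝ) (σ : Fin N → Strategy M)
    (h : Fin N) : ℝ :=
  expect R γ σ (fun s _ => s.earned h)

/-- Every human plans optimally: no human can increase their own expected discounted reward by
switching to any other strategy. -/
def IsOptimal (R : Fin N → Fin M → ℝ) (γ : Fin N → ℝ) (σ : Fin N → Strategy M) : Prop :=
  ∀ (h : Fin N) (τ : Strategy M), payoff R γ (Function.update σ h τ) h ≤ payoff R γ σ h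

/-- Normalized utility profiles: nonnegative rewards that sum to 1 for each human. -/
def IsUtilityProfile (R : Fin N → Fin M → ℝ) : Prop :=
  (∀ h a, 0 ≤ R h a) ∧ ∀ h, ∑ a, R h a = 1

/-- Utilitarian social welfare of an action. -/
def welfare (R : Fin N → Fin M → ℝ) (a : Fin M) : ℝ := ∑ h, R h a

/-- Expected utilitarian social welfare of the action returned by the mechanism. -/
noncomputable def expectedWelfare (R : Fin N → Fin M → ℝ) (γ : Fin N → ℝ)
    (σ : Fin N → Strategy M) : ℝ :=
  expect R γ σ (fun _ a => welfare R a)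

/-- The distortion of the mechanism for `N` humans with discount factors `γ` and `M` actions: the
worst ratio, over all utility profiles `R` and all optimal behaviours of the humans for `R`, of the
largest social welfare of an action to the expected social welfare of the returned action. -/
noncomputable def distortion (N M : ℕ) (γ : Fin N → ℝ) : ℝ≥0∞ :=
  ⨆ (R : Fin N → Fin M → ℝ) (_ : IsUtilityProfile R)
    (σ : Fin N → Strategy M) (_ : IsOptimal R γ σ),
    (⨆ a, ENNReal.ofReal (welfare R a)) / ENNReal.ofReal (expectedWelfare R γ σ)

end Collab

namespace Collab

/-! ### Effect of a round on a state -/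

variable {N M : ℕ} {R : Fin N → Fin M → ℝ} {γ : Fin N → ℝ} {σ : Fin N → Strategy M}

/-! For fixed strategies only the stopping time and the returned action are random. Summation by
parts writes the payoff of `h` as a combination, with strictly positive weights, of the rewards
collected in the first 1, ..., M rounds (`payoff_eq`). The first `k` rounds yield at most the `k`
largest rewards, and `greedy` attains all these bounds at once, whatever the others do. So optimal
behaviour exists, and every optimal behaviour attains all the bounds (`IsOptimal.collected_eq`).

Hence if `h` executes `a` with positive reward in round `t`, the `t - 1` earlier actions are worth
at least as much each; rewards sum to 1, so `R h a ≤ 1 / t`. Summing over humans, the score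
dominates the welfare (`IsOptimal.welfare_le_score`), while the total score `T` is at most `N *
harmonic M`.

The uniform draw has probability 1/2 and welfare `N / M`; the score-weighted draw gives at least `W
^ 2 / T` for any action of welfare `W`. AM-GM on these two halves gives the bound
(`IsOptimal.welfare_le`). -/

theorem step_history (t : ℕ) (s : State N M) (h : Fin N) :
    (step R γ σ t s h).history = s.history ++ [σ h s.history] := by
  unfold step; dsimp only; split_ifs <;> rfl

theorem step_actions (t : ℕ) (s : State N M) (h : Fin N) :
    (step R γ σ t s h).actions
      = Function.update s.actions h ((s.actions h).erase (σ h s.history)) := by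
  unfold step; dsimp only
  split_ifs with ha
  · rfl
  · rw [Finset.erase_eq_of_notMem ha, Function.update_eq_self]

/-- The difference of sums covers executed and ignored choices in one formula, and later becomes an
increment of `collected`. -/
theorem step_earned (t : ℕ) (s : State N M) (h : Fin N) :
    (step R γ σ t s h).earned
      = Function.update s.earned h (s.earned h + γ h ^ s.history.length *
          (∑ a ∈ s.actions h, R h a - ∑ a ∈ (s.actions h).erase (σ h s.history), R h a)) := by
  unfold step; dsimp only
  split_ifs with ha
  · rw [← Finset.add_sum_erase _ _ ha, add_sub_cancel_right]
  · simp [Finset.erase_eq_of_notMem ha]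

theorem step_score (t : ℕ) (s : State N M) (h : Fin N) (a : Fin M) :
    (step R γ σ t s h).score a = s.score a +
      ∑ h', if a ∈ s.actions h' \ (step R γ σ t s h).actions h' then 1 / (t : ℝ) else 0 := by
  have hsum : (∑ h', if a ∈ s.actions h' \ (step R γ σ t s h).actions h'
      then 1 / (t : ℝ) else 0)
      = if a ∈ s.actions h ∧ a = σ h s.history then 1 / (t : ℝ) else 0 := by
    rw [Finset.sum_eq_single h]
    · rw [step_actions]
      congr 1
      simp only [Function.update_self, Finset.mem_sdiff, Finset.mem_erase, eq_iff_iff]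
      tauto
    · intro h' _ hne
      rw [step_actions, Function.update_of_ne hne]
      simp
    · simp
  rw [hsum]
  unfold step; dsimp only
  split_ifs with h1 h2 h2
  · obtain ⟨_, rfl⟩ := h2
    simp
  · change Function.update _ _ _ a = _
    rw [Function.update_of_ne]
    · simp
    · rintro rfl
      exact h2 ⟨h1, rfl⟩
  · obtain ⟨h3, rfl⟩ := h2
    exact absurd h3 h1
  · simp

/-- The changes made to a state when the humans in a list choose one after the other. -/
theorem foldl_step (t : ℕ) (l : List (Fin N)) (hl : l.Nodup) (s : State N M) :
    (l.foldl (step R γ σ t) s).history.length = s.history.length + l.length ∧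
    (∀ h, (l.foldl (step R γ σ t) s).actions h ⊆ s.actions h) ∧
    (∀ h ∉ l, (l.foldl (step R γ σ t) s).actions h = s.actions h ∧
      (l.foldl (step R γ σ t) s).earned h = s.earned h) ∧
    (∀ i (hi : i < l.length), ∃ H : List (Fin M), H.length = s.history.length + i ∧
      (l.foldl (step R γ σ t) s).actions l[i] = (s.actions l[i]).erase (σ l[i] H) ∧
      (l.foldl (step R γ σ t) s).earned l[i] = s.earned l[i] +
        γ l[i] ^ (s.history.length + i) * (∑ a ∈ s.actions l[i], R l[i] a
          - ∑ a ∈ (l.foldl (step R γ σ t) s).actions l[i], R l[i] a)) ∧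
    (∀ a, (l.foldl (step R γ σ t) s).score a = s.score a +
      ∑ h, if a ∈ s.actions h \ (l.foldl (step R γ σ t) s).actions h
        then 1 / (t : ℝ) else 0) := by
  induction l generalizing s with
  | nil => simp
  | cons x l ih =>
    obtain ⟨hx, hl⟩ := List.nodup_cons.1 hl
    obtain ⟨ih1, ih2, ih3, ih4, ih5⟩ := ih hl (step R γ σ t s x)
    simp only [List.foldl_cons]
    set s1 := step R γ σ t s x with hs1
    set s2 := l.foldl (step R γ σ t) s1
    have hlen : s1.history.length = s.history.length + 1 := by
      rw [hs1, step_history]; simp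
    have hsub : ∀ h, s1.actions h ⊆ s.actions h := by
      intro h
      rw [hs1, step_actions]
      by_cases hh : h = x
      · subst hh; simpa using Finset.erase_subset _ _
      · rw [Function.update_of_ne hh]
    have hne : ∀ h, h ≠ x → s1.actions h = s.actions h ∧ s1.earned h = s.earned h := by
      intro h hh
      rw [hs1, step_actions, step_earned, Function.update_of_ne hh, Function.update_of_ne hh]
      exact ⟨rfl, rfl⟩
    refine ⟨?_, fun h => (ih2 h).trans (hsub h), ?_, ?_, ?_⟩
    · rw [ih1, hlen, List.length_cons]; ring
    · intro h hh
      rw [List.mem_cons, not_or] at hh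
      rw [(ih3 h hh.2).1, (ih3 h hh.2).2]
      exact hne h hh.1
    · intro i hi
      cases i with
      | zero =>
        refine ⟨s.history, rfl, ?_⟩
        simp only [List.getElem_cons_zero]
        rw [(ih3 x hx).1, (ih3 x hx).2, hs1, step_actions, step_earned]
        simp
      | succ i =>
        have hi' : i < l.length := by simpa using hi
        obtain ⟨H, hH1, hH2, hH3⟩ := ih4 i hi'
        have hxi : l[i] ≠ x := fun h => hx (h ▸ List.getElem_mem hi')
        simp only [List.getElem_cons_succ]
        refine ⟨H, by rw [hH1, hlen]; ring, ?_, ?_⟩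
        · rw [hH2, (hne _ hxi).1]
        · rw [hH3, (hne _ hxi).1, (hne _ hxi).2, hlen]
          congr 3; ring
    · intro a
      have hscore := step_score (R := R) (γ := γ) (σ := σ) t s x a
      rw [← hs1] at hscore
      change s2.score a = s.score a + ∑ h, if a ∈ s.actions h \ s2.actions h
        then 1 / (t : ℝ) else 0
      rw [ih5, hscore, add_assoc, ← Finset.sum_add_distrib]
      congr 1
      refine Finset.sum_congr rfl fun h _ => ?_
      -- The action sets shrink, so an action lost overall is lost either at this step or later,
      -- never both.
      have h1 := @hsub h a
      have h2 := @ih2 h a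
      simp only [Finset.mem_sdiff]
      by_cases p1 : a ∈ s.actions h <;> by_cases p2 : a ∈ s1.actions h <;>
        by_cases p3 : a ∈ s2.actions h <;> simp_all

/-! ### The run of the mechanism -/

variable (R γ σ) in
/-- The state after `j` rounds, provided that the robot has not stopped earlier. -/
noncomputable def stateAt : ℕ → State N M
  | 0 => State.init N M
  | j + 1 => playRound R γ σ (j + 1) (stateAt j)

variable (R γ σ) in
/-- The reward of the actions that human `h` has executed during the first `j` rounds. -/
noncomputable def collected (h : Fin N) (j : ℕ) : ℝ :=
  ∑ a ∈ ((stateAt R γ σ j).actions h)ᶜ, R h a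

theorem collected_eq_sub (h : Fin N) (j : ℕ) :
    collected R γ σ h j = ∑ a, R h a - ∑ a ∈ (stateAt R γ σ j).actions h, R h a := by
  rw [collected, eq_sub_iff_add_eq, Finset.sum_compl_add_sum]

@[simp] theorem collected_zero (h : Fin N) : collected R γ σ h 0 = 0 := by
  simp [collected, stateAt, State.init]

theorem history_length_stateAt (j : ℕ) : (stateAt R γ σ j).history.length = N * j := by
  induction j with
  | zero => simp [stateAt, State.init]
  | succ j ih =>
    rw [stateAt, playRound, (foldl_step _ _ (List.nodup_finRange N) _).1, ih, List.length_finRange]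
    ring

theorem exists_choice_stateAt (h : Fin N) (j : ℕ) :
    ∃ H : List (Fin M), H.length = N * j + h ∧
      (stateAt R γ σ (j + 1)).actions h = ((stateAt R γ σ j).actions h).erase (σ h H) ∧
      (stateAt R γ σ (j + 1)).earned h = (stateAt R γ σ j).earned h +
        γ h ^ (N * j + h) * (collected R γ σ h (j + 1) - collected R γ σ h j) := by
  obtain ⟨H, h1, h2, h3⟩ := (foldl_step (R := R) (γ := γ) (σ := σ) (j + 1) _
    (List.nodup_finRange N) (stateAt R γ σ j)).2.2.2.1 h (by simp)
  simp only [List.getElem_finRange, Fin.cast_mk, Fin.eta, history_length_stateAt] at h1 h2 h3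
  refine ⟨H, h1, h2, ?_⟩
  rw [collected_eq_sub, collected_eq_sub, sub_sub_sub_cancel_left]
  exact h3

theorem score_stateAt (n : ℕ) (a : Fin M) :
    (stateAt R γ σ n).score a = ∑ h, ∑ j ∈ Finset.range n,
      if a ∈ (stateAt R γ σ j).actions h \ (stateAt R γ σ (j + 1)).actions h
        then 1 / ((j : ℝ) + 1) else 0 := by
  induction n with
  | zero => simp [stateAt, State.init]
  | succ n ih =>
    simp only [Finset.sum_range_succ, Finset.sum_add_distrib]
    rw [← ih]
    have := (foldl_step (R := R) (γ := γ) (σ := σ) (n + 1) _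
      (List.nodup_finRange N) (stateAt R γ σ n)).2.2.2.2 a
    simpa [stateAt, playRound] using this

theorem card_compl_actions_le (h : Fin N) (j : ℕ) :
    ((stateAt R γ σ j).actions h)ᶜ.card ≤ j := by
  induction j with
  | zero => simp [stateAt, State.init]
  | succ j ih =>
    obtain ⟨H, -, hH, -⟩ := exists_choice_stateAt (R := R) (γ := γ) (σ := σ) h j
    rw [hH, Finset.compl_erase]
    exact (Finset.card_insert_le _ _).trans (by omega)

theorem score_nonneg (n : ℕ) (a : Fin M) : 0 ≤ (stateAt R γ σ n).score a := by
  rw [score_stateAt]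
  refine Finset.sum_nonneg fun h _ => Finset.sum_nonneg fun j _ => ?_
  split_ifs <;> positivity

theorem sum_score_stateAt (n : ℕ) :
    ∑ a, (stateAt R γ σ n).score a = ∑ h, ∑ j ∈ Finset.range n,
      (((stateAt R γ σ j).actions h \ (stateAt R γ σ (j + 1)).actions h).card : ℝ)
        * (1 / ((j : ℝ) + 1)) := by
  simp only [score_stateAt]
  rw [Finset.sum_comm]
  refine Finset.sum_congr rfl fun h _ => ?_
  rw [Finset.sum_comm]
  refine Finset.sum_congr rfl fun j _ => ?_
  rw [Finset.sum_ite_mem, Finset.univ_inter, Finset.sum_const, nsmul_eq_mul]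

/-- Each human executes at most one action per round, so round `t` adds at most `N / t`. -/
theorem sum_score_le (n : ℕ) :
    ∑ a, (stateAt R γ σ n).score a ≤ N * (harmonic n : ℝ) := by
  rw [sum_score_stateAt]
  have hb : ∀ h ∈ (Finset.univ : Finset (Fin N)), ∑ j ∈ Finset.range n,
      (((stateAt R γ σ j).actions h \ (stateAt R γ σ (j + 1)).actions h).card : ℝ)
        * (1 / ((j : ℝ) + 1)) ≤ (harmonic n : ℝ) := by
    intro h _
    rw [harmonic]
    push_cast
    refine Finset.sum_le_sum fun j _ => ?_
    obtain ⟨H, -, hH, -⟩ := exists_choice_stateAt (R := R) (γ := γ) (σ := σ) h j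
    have hc : ((stateAt R γ σ j).actions h \ (stateAt R γ σ (j + 1)).actions h).card ≤ 1 := by
      rw [hH]
      refine (Finset.card_le_card (t := {σ h H}) fun a => ?_).trans_eq (Finset.card_singleton _)
      simp only [Finset.mem_sdiff, Finset.mem_erase, Finset.mem_singleton]
      tauto
    rw [one_div]
    exact mul_le_of_le_one_left (by positivity) (by exact_mod_cast hc)
  simpa using Finset.sum_le_sum hb

/-- In round 1 nothing has been removed yet, so the first choice is always executed. -/
theorem sum_score_pos (hN : 1 ≤ N) {n : ℕ} (hn : 1 ≤ n) :
    0 < ∑ a, (stateAt R γ σ n).score a := by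
  rw [sum_score_stateAt]
  have hnn : ∀ (h : Fin N) (j : ℕ), 0 ≤
      (((stateAt R γ σ j).actions h \ (stateAt R γ σ (j + 1)).actions h).card : ℝ)
        * (1 / ((j : ℝ) + 1)) := fun h j => by positivity
  refine Finset.sum_pos' (fun h _ => Finset.sum_nonneg fun j _ => hnn h j)
    ⟨⟨0, hN⟩, Finset.mem_univ _, Finset.sum_pos' (fun j _ => hnn _ j)
      ⟨0, Finset.mem_range.2 hn, ?_⟩⟩
  obtain ⟨H, -, hH, -⟩ := exists_choice_stateAt (R := R) (γ := γ) (σ := σ) ⟨0, hN⟩ 0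
  have : 0 < ((stateAt R γ σ 0).actions ⟨0, hN⟩ \
      (stateAt R γ σ (0 + 1)).actions ⟨0, hN⟩).card := by
    rw [hH, Finset.card_pos]
    exact ⟨σ ⟨0, hN⟩ H, by simp [stateAt, State.init]⟩
  have : (0 : ℝ) < (((stateAt R γ σ 0).actions ⟨0, hN⟩ \
      (stateAt R γ σ (0 + 1)).actions ⟨0, hN⟩).card : ℝ) := by exact_mod_cast this
  positivity

/-! ### Expectations -/

theorem expectFrom_stateAt (f : State N M → Fin M → ℝ) (k j : ℕ) :
    expectFrom R γ σ f k (j + 1) (stateAt R γ σ j) =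
      stopProb M * ∑ i ∈ Finset.range k, (1 - stopProb M) ^ i *
        (∑ a, 1 / (M : ℝ) * f (stateAt R γ σ (j + i + 1)) a) +
      (1 - stopProb M) ^ k * ∑ a, (stateAt R γ σ (j + k)).score a /
        (∑ a', (stateAt R γ σ (j + k)).score a') * f (stateAt R γ σ (j + k)) a := by
  induction k generalizing j with
  | zero => simp [expectFrom]
  | succ k ih =>
    rw [expectFrom, ← stateAt, ih (j + 1), Finset.sum_range_succ']
    have h1 : ∀ i, j + 1 + i + 1 = j + (i + 1) + 1 := fun i => by ring
    have h2 : j + 1 + k = j + (k + 1) := by ring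
    simp only [h1, h2, pow_succ, mul_add, Finset.mul_sum, add_zero, pow_zero, one_mul]
    rw [add_comm, add_assoc, add_assoc]
    congr 1
    · exact Finset.sum_congr rfl fun i _ => Finset.sum_congr rfl fun a _ => by ring
    · rw [add_comm]
      congr 1
      exact Finset.sum_congr rfl fun a _ => by ring

theorem expect_eq (f : State N M → Fin M → ℝ) :
    expect R γ σ f =
      stopProb M * ∑ i ∈ Finset.range M, (1 - stopProb M) ^ i *
        (∑ a, 1 / (M : ℝ) * f (stateAt R γ σ (i + 1)) a) +
      (1 - stopProb M) ^ M * ∑ a, (stateAt R γ σ M).score a /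
        (∑ a', (stateAt R γ σ M).score a') * f (stateAt R γ σ M) a := by
  simpa [expect, stateAt] using expectFrom_stateAt (R := R) (γ := γ) (σ := σ) f M 0

/-- Summation by parts against a geometric sequence. -/
theorem sum_geom_mul_sub (c : ℝ) (u : ℕ → ℝ) (hu : u 0 = 0) (n : ℕ) :
    ∑ j ∈ Finset.range n, c ^ j * (u (j + 1) - u j)
      = (1 - c) * ∑ j ∈ Finset.range n, c ^ j * u (j + 1) + c ^ n * u n := by
  induction n with
  | zero => simp [hu]
  | succ n ih => rw [Finset.sum_range_succ, Finset.sum_range_succ, ih]; ring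

theorem one_sub_stopProb_pos (M : ℕ) : 0 < 1 - stopProb M := by
  rw [stopProb]; simp only [sub_sub_cancel]; positivity

theorem one_sub_stopProb_le_one (M : ℕ) : 1 - stopProb M ≤ 1 := by
  rw [stopProb, sub_sub_cancel]
  exact (div_le_one (by positivity)).2 (Real.one_le_rpow (by norm_num) (by positivity))

theorem one_sub_stopProb_pow (hM : M ≠ 0) : (1 - stopProb M) ^ M = 1 / 2 := by
  have : (M : ℝ) ≠ 0 := by exact_mod_cast hM
  rw [stopProb, sub_sub_cancel, div_pow, one_pow, ← Real.rpow_natCast, ← Real.rpow_mul (by norm_num),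
    one_div_mul_cancel this, Real.rpow_one]

/-- The factor by which the value of a reward decreases from one round to the next. -/
noncomputable def roundDiscount (N M : ℕ) (g : ℝ) : ℝ := (1 - stopProb M) * g ^ N

theorem roundDiscount_pos {g : ℝ} (hg : 0 < g) : 0 < roundDiscount N M g :=
  mul_pos (one_sub_stopProb_pos M) (pow_pos hg N)

theorem roundDiscount_lt_one (hN : 1 ≤ N) {g : ℝ} (hg : 0 < g) (hg1 : g < 1) :
    roundDiscount N M g < 1 :=
  (mul_le_of_le_one_left (pow_nonneg hg.le N) (one_sub_stopProb_le_one M)).trans_lt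
    (pow_lt_one₀ hg.le hg1 (by omega))

variable (R γ σ) in
theorem payoff_eq (hM : 1 ≤ M) (hN : 1 ≤ N) (h : Fin N) :
    payoff R γ σ h = γ h ^ (h : ℕ) *
      ((1 - roundDiscount N M (γ h)) * ∑ j ∈ Finset.range M,
          roundDiscount N M (γ h) ^ j * collected R γ σ h (j + 1)
        + roundDiscount N M (γ h) ^ M * collected R γ σ h M) := by
  have hM' : (M : ℝ) ≠ 0 := by exact_mod_cast (by omega : M ≠ 0)
  have hT := (sum_score_pos (R := R) (γ := γ) (σ := σ) hN hM).ne'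
  have h0 : (stateAt R γ σ 0).earned h = 0 := by simp [stateAt, State.init]
  -- Summation by parts is used twice: here to weight each earning by the probability that its round
  -- is played, and backwards on `collected` with ratio `roundDiscount`.
  have h1 := sum_geom_mul_sub (1 - stopProb M) (fun j => (stateAt R γ σ j).earned h) h0 M
  rw [payoff, expect_eq, ← sum_geom_mul_sub _ _ (collected_zero h)]
  simp only [← Finset.sum_mul, ← Finset.sum_div, div_self hT, one_mul, Finset.sum_const,
    Finset.card_univ, Fintype.card_fin, nsmul_eq_mul, mul_one, div_self hM']
  rw [sub_sub_cancel] at h1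
  rw [← h1, Finset.mul_sum]
  refine Finset.sum_congr rfl fun j _ => ?_
  obtain ⟨H, -, -, hH⟩ := exists_choice_stateAt (R := R) (γ := γ) (σ := σ) h j
  rw [hH, roundDiscount, mul_pow, ← pow_mul, pow_add]
  ring

/-! ### Planning optimally -/

/-- An enumeration of the actions by non-increasing reward. -/
noncomputable def ranking (r : Fin M → ℝ) : Equiv.Perm (Fin M) := Tuple.sort (fun a => -r a)

theorem ranking_antitone (r : Fin M → ℝ) : Antitone (r ∘ ranking r) := by
  intro i j hij
  have := Tuple.monotone_sort (fun a => -r a) hij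
  simpa [ranking] using this

/-- The `k` best actions. -/
noncomputable def topSet (r : Fin M → ℝ) (k : ℕ) : Finset (Fin M) :=
  Finset.univ.filter fun a => ((ranking r).symm a : ℕ) < k

theorem card_topSet (r : Fin M → ℝ) {k : ℕ} (hk : k ≤ M) : (topSet r k).card = k := by
  have : topSet r k = (Finset.univ.filter fun i : Fin M => (i : ℕ) < k).map
      (ranking r).toEmbedding := by
    ext a; simp [topSet, Finset.mem_map_equiv]
  rw [this, Finset.card_map, Fin.card_filter_val_lt, min_eq_right hk]

theorem topSet_self (r : Fin M → ℝ) : topSet r M = Finset.univ := by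
  ext a; simp [topSet]

theorem sum_le_sum_topSet {r : Fin M → ℝ} (hr : ∀ a, 0 ≤ r a) {k : ℕ} (hk : k ≤ M)
    (A : Finset (Fin M)) (hA : A.card ≤ k) : ∑ a ∈ A, r a ≤ ∑ a ∈ topSet r k, r a := by
  rcases Nat.eq_zero_or_pos k with rfl | hk0
  · obtain rfl : A = ∅ := Finset.card_eq_zero.1 (by omega)
    exact Finset.sum_nonneg fun a _ => hr a
  -- The `k`-th largest value: `r - θ` is nonnegative on `topSet r k` and nonpositive off it.
  set θ := r (ranking r ⟨k - 1, by omega⟩) with hθ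
  have hin : ∀ a ∈ topSet r k, 0 ≤ r a - θ := by
    intro a ha
    have hlt : ((ranking r).symm a : ℕ) < k := by simpa [topSet] using ha
    have := ranking_antitone r (a := (ranking r).symm a) (b := ⟨k - 1, by omega⟩)
      (Fin.le_def.2 (by simp only; omega))
    simp only [Function.comp_apply, Equiv.apply_symm_apply] at this
    linarith
  have hout : ∀ a ∉ topSet r k, r a - θ ≤ 0 := by
    intro a ha
    have hlt : k ≤ ((ranking r).symm a : ℕ) := by simpa [topSet] using ha
    have := ranking_antitone r (a := ⟨k - 1, by omega⟩) (b := (ranking r).symm a)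
      (Fin.le_def.2 (by simp only; omega))
    simp only [Function.comp_apply, Equiv.apply_symm_apply] at this
    linarith
  have h1 : ∑ a ∈ A, (r a - θ) ≤ ∑ a ∈ topSet r k, (r a - θ) := by
    calc ∑ a ∈ A, (r a - θ) ≤ ∑ a ∈ A, if a ∈ topSet r k then r a - θ else 0 := by
          refine Finset.sum_le_sum fun a _ => ?_
          split_ifs with h
          · rfl
          · exact hout a h
      _ ≤ ∑ a, if a ∈ topSet r k then r a - θ else 0 := by
          refine Finset.sum_le_sum_of_subset_of_nonneg (Finset.subset_univ _) fun a _ _ => ?_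
          split_ifs with h
          · exact hin a h
          · rfl
      _ = _ := by rw [Finset.sum_ite_mem, Finset.univ_inter]
  simp only [Finset.sum_sub_distrib, Finset.sum_const, nsmul_eq_mul, card_topSet r hk] at h1
  have h2 : (A.card : ℝ) * θ ≤ k * θ :=
    mul_le_mul_of_nonneg_right (by exact_mod_cast hA) (hr _)
  linarith

theorem collected_le (hR : IsUtilityProfile R) (h : Fin N) {k : ℕ} (hk : k ≤ M) :
    collected R γ σ h k ≤ ∑ a ∈ topSet (R h) k, R h a :=
  sum_le_sum_topSet (hR.1 h) hk _ (card_compl_actions_le h k)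

/-- The strategy of choosing the actions by non-increasing reward, one in each round. -/
noncomputable def greedy (N : ℕ) (hM : 1 ≤ M) (r : Fin M → ℝ) : Strategy M :=
  fun H => ranking r ⟨(H.length / N) % M, Nat.mod_lt _ hM⟩

theorem collected_greedy (hM : 1 ≤ M) (h : Fin N) (hσ : σ h = greedy N hM (R h)) {k : ℕ}
    (hk : k ≤ M) : collected R γ σ h k = ∑ a ∈ topSet (R h) k, R h a := by
  have key : ((stateAt R γ σ k).actions h)ᶜ = topSet (R h) k := by
    induction k with
    | zero => simp [stateAt, State.init, topSet]
    | succ k ih =>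
      obtain ⟨H, hH, hA, -⟩ := exists_choice_stateAt (R := R) (γ := γ) (σ := σ) h k
      -- The history length reveals the round; the reduction modulo `M` in `greedy` is vacuous
      -- during the run.
      have hd : (N * k + h) / N = k := by
        rw [Nat.mul_add_div h.pos, Nat.div_eq_of_lt h.isLt, add_zero]
      have hm : k % M = k := Nat.mod_eq_of_lt hk
      rw [hA, Finset.compl_erase, ih (by omega), hσ]
      ext a
      simp only [greedy, hH, hd, hm, Finset.mem_insert, topSet, Finset.mem_filter,
        Finset.mem_univ, true_and, Nat.lt_succ_iff_lt_or_eq]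
      rw [← Equiv.symm_apply_eq, Fin.ext_iff]
      tauto
  rw [collected, key]

theorem isOptimal_greedy (hM : 1 ≤ M) (hN : 1 ≤ N) (hγ : ∀ h, 0 < γ h ∧ γ h < 1)
    (hR : IsUtilityProfile R) : IsOptimal R γ fun h => greedy N hM (R h) := by
  intro h τ
  have hc := roundDiscount_pos (N := N) (M := M) (hγ h).1
  have hc1 := roundDiscount_lt_one (M := M) hN (hγ h).1 (hγ h).2
  have hle : ∀ k ≤ M, collected R γ (Function.update (fun h => greedy N hM (R h)) h τ) h k
      ≤ collected R γ (fun h => greedy N hM (R h)) h k := fun k hk => by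
    rw [collected_greedy (σ := fun h => greedy N hM (R h)) hM h rfl hk]
    exact collected_le hR h hk
  rw [payoff_eq _ _ _ hM hN, payoff_eq _ _ _ hM hN]
  refine mul_le_mul_of_nonneg_left (add_le_add (mul_le_mul_of_nonneg_left
    (Finset.sum_le_sum fun j hj => mul_le_mul_of_nonneg_left
      (hle _ (Finset.mem_range.1 hj)) (pow_nonneg hc.le _)) (sub_nonneg.2 hc1.le))
    (mul_le_mul_of_nonneg_left (hle _ le_rfl) (pow_nonneg hc.le _))) (pow_nonneg (hγ h).1.le _)

/-- All weights in `payoff_eq` are positive, so a deficit at a single `k` would make deviating to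
`greedy` strictly profitable. -/
theorem IsOptimal.collected_eq (hM : 1 ≤ M) (hN : 1 ≤ N) (hγ : ∀ h, 0 < γ h ∧ γ h < 1)
    (hR : IsUtilityProfile R) (hσ : IsOptimal R γ σ) (h : Fin N) {k : ℕ} (hk : k ≤ M) :
    collected R γ σ h k = ∑ a ∈ topSet (R h) k, R h a := by
  have hc := roundDiscount_pos (N := N) (M := M) (hγ h).1
  have hc1 := roundDiscount_lt_one (M := M) hN (hγ h).1 (hγ h).2
  have hopt := hσ h (greedy N hM (R h))
  have hg : ∀ k ≤ M, collected R γ (Function.update σ h (greedy N hM (R h))) h k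
      = ∑ a ∈ topSet (R h) k, R h a := fun k hk =>
    collected_greedy hM h (by simp) hk
  rcases k with _ | k
  · simp [topSet]
  refine (collected_le hR h hk).antisymm (not_lt.1 fun hlt => hopt.not_gt ?_)
  rw [payoff_eq _ _ _ hM hN, payoff_eq _ _ _ hM hN]
  refine mul_lt_mul_of_pos_left (add_lt_add_of_lt_of_le (mul_lt_mul_of_pos_left
    (Finset.sum_lt_sum (fun j hj => mul_le_mul_of_nonneg_left ?_ (pow_nonneg hc.le _))
      ⟨k, Finset.mem_range.2 hk, mul_lt_mul_of_pos_left ?_ (pow_pos hc _)⟩) (sub_pos.2 hc1))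
    (mul_le_mul_of_nonneg_left ?_ (pow_nonneg hc.le _))) (pow_pos (hγ h).1 _)
  · rw [hg _ (Finset.mem_range.1 hj)]
    exact collected_le hR h (Finset.mem_range.1 hj)
  · rwa [hg _ hk]
  · rw [hg _ le_rfl]
    exact collected_le hR h le_rfl

/-- A set of largest sum among the sets with at most `k` elements has average at least the value
of any element outside of it. -/
theorem mul_le_sum_of_maximal {r : Fin M → ℝ} {A : Finset (Fin M)} {k : ℕ} (hA : A.card ≤ k)
    (hmax : ∀ B : Finset (Fin M), B.card ≤ k → ∑ a ∈ B, r a ≤ ∑ a ∈ A, r a)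
    {a : Fin M} (ha : a ∉ A) (hpos : 0 < r a) : k * r a ≤ ∑ b ∈ A, r b := by
  have hcard : A.card = k := by
    by_contra hne
    have := hmax (insert a A) ((Finset.card_insert_le _ _).trans (by omega))
    rw [Finset.sum_insert ha] at this
    linarith
  have hge : ∀ b ∈ A, r a ≤ r b := by
    intro b hb
    have ha' : a ∉ A.erase b := fun h => ha (Finset.mem_of_mem_erase h)
    -- Exchanging `b` for `a` cannot increase the sum.
    have := hmax (insert a (A.erase b)) (by
      rw [Finset.card_insert_of_notMem ha', Finset.card_erase_of_mem hb]
      have := Finset.card_pos.2 ⟨b, hb⟩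
      omega)
    rw [Finset.sum_insert ha', ← Finset.add_sum_erase A r hb] at this
    linarith
  have := Finset.card_nsmul_le_sum A r (r a) hge
  rwa [hcard, nsmul_eq_mul] at this

theorem IsOptimal.reward_le (hM : 1 ≤ M) (hN : 1 ≤ N) (hγ : ∀ h, 0 < γ h ∧ γ h < 1)
    (hR : IsUtilityProfile R) (hσ : IsOptimal R γ σ) (h : Fin N) (a : Fin M) :
    R h a ≤ ∑ j ∈ Finset.range M,
      if a ∈ (stateAt R γ σ j).actions h \ (stateAt R γ σ (j + 1)).actions h
        then 1 / ((j : ℝ) + 1) else 0 := by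
  have hnn : ∀ j ∈ Finset.range M,
      0 ≤ if a ∈ (stateAt R γ σ j).actions h \ (stateAt R γ σ (j + 1)).actions h
        then 1 / ((j : ℝ) + 1) else 0 := fun j _ => by split_ifs <;> positivity
  rcases (hR.1 h a).eq_or_lt with h0 | hpos
  · rw [← h0]; exact Finset.sum_nonneg hnn
  -- All reward is collected after `M` rounds, so an action never executed has reward zero.
  have hend : a ∉ (stateAt R γ σ M).actions h := by
    intro ha
    have h1 := hσ.collected_eq hM hN hγ hR h le_rfl
    rw [collected_eq_sub, topSet_self] at h1
    have := Finset.single_le_sum (f := R h) (fun b _ => hR.1 h b) ha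
    linarith
  classical
  have hex : ∃ n, a ∉ (stateAt R γ σ n).actions h := ⟨M, hend⟩
  obtain ⟨j, hj⟩ : ∃ j, Nat.find hex = j + 1 := by
    refine Nat.exists_eq_succ_of_ne_zero fun h0 => ?_
    have := Nat.find_spec hex
    rw [h0] at this
    simp [stateAt, State.init] at this
  have hjM : j < M := by have := Nat.find_le (h := hex) hend; omega
  have hout : a ∉ (stateAt R γ σ (j + 1)).actions h := hj ▸ Nat.find_spec hex
  have hin : a ∈ (stateAt R γ σ j).actions h :=
    not_not.1 (Nat.find_min hex (by omega))
  refine le_trans ?_ (Finset.single_le_sum hnn (Finset.mem_range.2 hjM))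
  rw [if_pos (Finset.mem_sdiff.2 ⟨hin, hout⟩), le_div_iff₀ (by positivity)]
  -- The `j` actions executed before `a` total at least `j * R h a`; together with `a` itself they
  -- fit into total reward 1.
  have h1 := mul_le_sum_of_maximal (r := R h)
    (card_compl_actions_le (R := R) (γ := γ) (σ := σ) h j) (fun B hB => by
      have := hσ.collected_eq hM hN hγ hR h hjM.le
      rw [collected] at this
      rw [this]
      exact sum_le_sum_topSet (hR.1 h) hjM.le B hB) (by simpa using hin) hpos
  have h2 : R h a ≤ ∑ b ∈ (stateAt R γ σ j).actions h, R h b :=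
    Finset.single_le_sum (f := R h) (fun b _ => hR.1 h b) hin
  have h3 := Finset.sum_compl_add_sum ((stateAt R γ σ j).actions h) (R h)
  rw [hR.2 h] at h3
  linarith

theorem IsOptimal.welfare_le_score (hM : 1 ≤ M) (hN : 1 ≤ N) (hγ : ∀ h, 0 < γ h ∧ γ h < 1)
    (hR : IsUtilityProfile R) (hσ : IsOptimal R γ σ) (a : Fin M) :
    welfare R a ≤ (stateAt R γ σ M).score a := by
  rw [score_stateAt]
  exact Finset.sum_le_sum fun h _ => hσ.reward_le hM hN hγ hR h a

/-! ### The distortion -/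

theorem expectedWelfare_eq (hM : 1 ≤ M) (hR : IsUtilityProfile R) :
    expectedWelfare R γ σ = 1 / 2 * (N / M) + 1 / 2 * ∑ a, (stateAt R γ σ M).score a /
      (∑ a', (stateAt R γ σ M).score a') * welfare R a := by
  have hsum : ∑ a, welfare R a = N := by
    simp only [welfare]
    rw [Finset.sum_comm]
    simp [hR.2]
  rw [expectedWelfare, expect_eq, one_sub_stopProb_pow (by omega)]
  congr 1
  simp only [← Finset.mul_sum, ← Finset.sum_mul, hsum]
  have hg := geom_sum_mul_neg (1 - stopProb M) M
  rw [sub_sub_cancel, one_sub_stopProb_pow (by omega)] at hg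
  linear_combination (1 / (M : ℝ) * N) * hg

theorem IsOptimal.welfare_le (hM : 2 ≤ M) (hN : 1 ≤ N) (hγ : ∀ h, 0 < γ h ∧ γ h < 1)
    (hR : IsUtilityProfile R) (hσ : IsOptimal R γ σ) (a : Fin M) :
    welfare R a ≤ 2 * Real.sqrt (M * Real.log M) * expectedWelfare R γ σ := by
  have hM1 : 1 ≤ M := by omega
  have hM0 : (0 : ℝ) < M := by exact_mod_cast hM1
  have hN0 : (0 : ℝ) < N := by exact_mod_cast hN
  have hw : ∀ b, 0 ≤ welfare R b := fun b => Finset.sum_nonneg fun h _ => hR.1 h b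
  have hT := sum_score_pos (R := R) (γ := γ) (σ := σ) hN hM1
  set T := ∑ b, (stateAt R γ σ M).score b
  set W := welfare R a
  -- Since `M ≥ 2`, `1 ≤ 3 * log 2 ≤ 3 * log M` absorbs the additive 1; the 4 becomes the final
  -- factor 2 under the root.
  have hlog : (harmonic M : ℝ) ≤ 4 * Real.log M := by
    have h1 := harmonic_le_one_add_log M
    have h2 : Real.log 2 ≤ Real.log M := Real.log_le_log (by norm_num) (by exact_mod_cast hM)
    have h3 := Real.log_two_gt_d9
    linarith
  have hTle : T ≤ N * (4 * Real.log M) :=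
    (sum_score_le M).trans (mul_le_mul_of_nonneg_left hlog hN0.le)
  -- Only the term of `a` is kept, with its score bounded below by `W`.
  have hterm : W * W / T ≤
      ∑ b, (stateAt R γ σ M).score b / T * welfare R b := by
    refine le_trans ?_ (Finset.single_le_sum (f := fun b =>
      (stateAt R γ σ M).score b / T * welfare R b) (fun b _ =>
        mul_nonneg (div_nonneg (score_nonneg M b) hT.le) (hw b)) (Finset.mem_univ a))
    rw [div_mul_eq_mul_div]
    gcongr
    · exact hw a
    · exact hσ.welfare_le_score hM1 hN hγ hR a
  have hE : 1 / 2 * (N / M) + 1 / 2 * (W * W / T) ≤ expectedWelfare R γ σ := by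
    rw [expectedWelfare_eq hM1 hR]
    linarith
  have hx : 0 ≤ (N : ℝ) / M := by positivity
  have hy : 0 ≤ W * W / T := div_nonneg (mul_self_nonneg _) hT.le
  have hE0 : 0 ≤ expectedWelfare R γ σ := by linarith
  -- AM-GM, squared: `x * y ≤ ((x + y) / 2) ^ 2`.
  have hsq : (N / M) * (W * W / T) ≤ expectedWelfare R γ σ ^ 2 := by
    have := pow_le_pow_left₀ (by positivity) hE 2
    nlinarith [sq_nonneg ((N : ℝ) / M - W * W / T)]
  have hWW : W ^ 2 ≤ (M * (4 * Real.log M)) * ((N / M) * (W * W / T)) := by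
    have : (M * (4 * Real.log M)) * ((N / M) * (W * W / T))
        = (N * (4 * Real.log M)) / T * W ^ 2 := by field_simp
    rw [this]
    exact le_mul_of_one_le_left (sq_nonneg _) ((one_le_div hT).2 hTle)
  have hl0 : 0 ≤ Real.log M := Real.log_natCast_nonneg M
  refine le_of_sq_le_sq ?_ (by positivity)
  rw [mul_pow, mul_pow, Real.sq_sqrt (by positivity)]
  calc W ^ 2 ≤ _ := hWW
    _ ≤ (M * (4 * Real.log M)) * expectedWelfare R γ σ ^ 2 :=
        mul_le_mul_of_nonneg_left hsq (by positivity)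
    _ = _ := by ring

theorem distortion_le (hM : 2 ≤ M) (hN : 1 ≤ N) (hγ : ∀ h, 0 < γ h ∧ γ h < 1) :
    distortion N M γ ≤ ENNReal.ofReal (2 * Real.sqrt (M * Real.log M)) := by
  refine iSup_le fun R => iSup_le fun hR => iSup_le fun σ => iSup_le fun hσ => ?_
  refine ENNReal.div_le_of_le_mul (iSup_le fun a => ?_)
  rw [← ENNReal.ofReal_mul (by positivity)]
  exact ENNReal.ofReal_le_ofReal (hσ.welfare_le hM hN hγ hR a)

end Collab

theorem mainTheorem4 :
    ∃ C : ℝ, 0 < C ∧ ∀ (M : ℕ), 2 ≤ M → ∀ (N : ℕ), 1 ≤ N →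
      ∀ (γ : Fin N → ℝ), (∀ h, 0 < γ h ∧ γ h < 1) →
        (∀ R : Fin N → Fin M → ℝ, Collab.IsUtilityProfile R →
          ∃ σ : Fin N → Collab.Strategy M, Collab.IsOptimal R γ σ) ∧
        Collab.distortion N M γ ≤ ENNReal.ofReal (C * Real.sqrt (M * Real.log M)) :=
  ⟨2, two_pos, fun _M hM _N hN _γ hγ =>
    ⟨fun _R hR => ⟨_, Collab.isOptimal_greedy (by omega) hN hγ hR⟩,
      Collab.distortion_le hM hN hγ⟩⟩
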